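/- For integers $0\le k\le d$ and a polyhedron $P\subseteq\mathbb{R}^d$ let $f_k(P)$ be the number of $k$-dimensional faces of $P$, so $f_0(P)$ is the number of its vertices. Let $n>d$ be natural numbers such that $\lfloor d/2\rfloor$ divides $n$ if $d$ is even and divides $n-1$ if $d$ is odd (this forces $d\ge 2$). A dual cyclic polytope $c^*(n,d)$ is the polar dual $\{y\in\mathbb{R}^d : \langle y, x-p\rangle\le 1 \text{ for all } x\in K\}$ of a cyclic polytope $K=\mathrm{conv}\{(t_i,t_i^2,\dots,t_i^d) : 1\le i\le n\}$, $t_1<\dots<t_n$, with respect to a point $p$ in the interior of $K$. A polyhedron $P^*(n,d)\subseteq\mathbb{R}^d$ is one of the following form. Put $m=n/\lfloor d/2\rfloor$ if $d$ is even and $m=(n-1)/\lfloor d/2\rfloor$ if $d$ is odd. For $1\le i\le\lfloor d/2\rfloor$ let $P_i^*\subseteq\mathbb{R}^2$ be a bounded convex polygon given by $m$ linear inequalities and having exactly $m$ vertices. Then $$P^*(n,d)=\{x\in\mathbb{R}^d : (x_{2i-1},x_{2i})\in P_i^* \text{ for all } 1\le i\le\lfloor d/2\rfloor\},$$ with the additional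 constraint $x_d\ge 0$ if $d$ is odd. Lemma. There is an absolute constant $C>0$ (independent of $n$, of $d$ and of all the choices above) such that for all such $n$ and $d$, every dual cyclic polytope $c^*(n,d)$ and every $P^*(n,d)$, $$f_0(c^*(n,d))\le C\,e^{\lfloor d/2\rfloor}\, f_0(P^*(n,d)).$$ -/

import Mathlib

open scoped Matrix

/-- `F` is a `k`-face of `P`: a nonempty subset of `P` on which some linear functional attains
exactly its maximum over `P`, and whose affine hull has dimension `k`. -/
def IsFace {d : ℕ} (k : ℕ) (P F : Set (Fin d → ℝ)) : Prop :=
  F.Nonempty ∧ IsExposed ℝ P F ∧ Module.finrank ℝ (vectorSpan ℝ F) = k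

/-- The number `f_k(P)` of `k`-faces of `P`. -/
noncomputable def numFaces {d : ℕ} (k : ℕ) (P : Set (Fin d → ℝ)) : ℕ :=
  {F : Set (Fin d → ℝ) | IsFace k P F}.ncard

/-- The moment curve `t ↦ (t, t², …, t^d)`. -/
def momentCurve (d : ℕ) (t : ℝ) : Fin d → ℝ := fun j => t ^ ((j : ℕ) + 1)

/-- The cyclic polytope: the convex hull of the points of the moment curve with the `n`
parameters `t`. -/
def cyclicPolytope {n : ℕ} (d : ℕ) (t : Fin n → ℝ) : Set (Fin d → ℝ) :=
  convexHull ℝ (Set.range fun i => momentCurve d (t i))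

/-- The (one-sided) polar dual of `S` with respect to the point `p`. -/
def polarDual {d : ℕ} (p : Fin d → ℝ) (S : Set (Fin d → ℝ)) : Set (Fin d → ℝ) :=
  {y | ∀ x ∈ S, y ⬝ᵥ (x - p) ≤ 1}

/-- `c` is a dual cyclic polytope `c*(n,d)`: the polar dual of a `d`-dimensional cyclic polytope
on `n` points with respect to one of its interior points. -/
def IsDualCyclicPolytope (n d : ℕ) (c : Set (Fin d → ℝ)) : Prop :=
  ∃ t : Fin n → ℝ, StrictMono t ∧
    ∃ p ∈ interior (cyclicPolytope d t), c = polarDual p (cyclicPolytope d t)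

/-- `Q` is a (bounded, convex) polygon in the plane given by `m` linear constraints and having
`m` vertices. -/
def IsPolygon (m : ℕ) (Q : Set (Fin 2 → ℝ)) : Prop :=
  Bornology.IsBounded Q ∧ numFaces 0 Q = m ∧
    ∃ (A : Matrix (Fin m) (Fin 2) ℝ) (b : Fin m → ℝ), Q = {x | A *ᵥ x ≤ b}

/-- The `i`-th pair of consecutive coordinates of `x`; with coordinates counted from `1` and pairs
from `1` this is `(x_{2i-1}, x_{2i})`. -/
def coordPair {d : ℕ} (x : Fin d → ℝ) (i : Fin (d / 2)) : Fin 2 → ℝ :=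
  ![x ⟨2 * (i : ℕ), by omega⟩, x ⟨2 * (i : ℕ) + 1, by omega⟩]

/-- `P` is a polytope `P*(n,d)`: each of the `⌊d/2⌋` consecutive pairs of coordinates is
constrained to a polygon with `n / ⌊d/2⌋` (`d` even) or `(n - 1) / ⌊d/2⌋` (`d` odd) constraints
and as many vertices, and for odd `d` there is the further constraint `x_d ≥ 0`. -/
def IsPStar (n d : ℕ) (P : Set (Fin d → ℝ)) : Prop :=
  ∃ Q : Fin (d / 2) → Set (Fin 2 → ℝ),
    (∀ i, IsPolygon (if Even d then n / (d / 2) else (n - 1) / (d / 2)) (Q i)) ∧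
    P = {x | (∀ i, coordPair x i ∈ Q i) ∧
      ∀ h : Odd d, 0 ≤ x ⟨d - 1, Nat.sub_lt h.pos one_pos⟩}

/-! Let `k = d / 2`, let `N` be `n` or `n - 1` according to the parity of `d`, and write `N = m *
k`. Vertices are counted as exposed points. Picking a vertex of each polygon gives a vertex of the
product, so `P*` has at least `m ^ k` vertices (`pow_le_numFaces_coordPairProduct`). A vertex `y` of
the dual cyclic polytope is determined by its set `Z` of active constraints, the nodes where a
polynomial of degree at most `d`, nonnegative at all nodes, vanishes. Here `|Z| = d`, so comparing
signs gives Gale's condition: the number of zeros above a node outside `Z` has constant parity. For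
each parity `Z` is recovered from a `k`-subset of at most `N` nodes, whence at most `2 * N.choose k`
vertices (`numFaces_polarDual_cyclicPolytope_le`). Finally `(m * k).choose k ≤ (m * k) ^ k / k! ≤ (e
* m) ^ k`. -/

theorem numFaces_zero_eq_ncard_exposedPoints {d : ℕ} (P : Set (Fin d → ℝ)) :
    numFaces 0 P = (P.exposedPoints ℝ).ncard := by
  have h : {F : Set (Fin d → ℝ) | IsFace 0 P F} = (fun x => {x}) '' P.exposedPoints ℝ := by
    ext F
    constructor
    · rintro ⟨⟨x, hx⟩, hF, h0⟩
      have hs : F.Subsingleton := (vectorSpan_eq_bot_iff_subsingleton ℝ).1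
        (Submodule.finrank_eq_zero.1 h0)
      have hFx : F = {x} := hs.eq_singleton_of_mem hx
      refine ⟨x, ?_, hFx.symm⟩
      rw [mem_exposedPoints_iff_exposed_singleton, ← hFx]
      exact hF
    · rintro ⟨x, hx, rfl⟩
      refine ⟨Set.singleton_nonempty x, mem_exposedPoints_iff_exposed_singleton.1 hx, ?_⟩
      simp
  rw [numFaces, h, Set.ncard_image_of_injective _ Set.singleton_injective]

/-! ### Extreme points of polyhedra and their active constraints -/

section Polyhedron

variable {ι E : Type*} [Finite ι] [AddCommGroup E] [Module ℝ E]

/-- At an extreme point of a polyhedron the active constraints have no common kernel vector. -/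
theorem eq_zero_of_mem_extremePoints_polyhedron (f : ι → E →ₗ[ℝ] ℝ) (b : ι → ℝ) {y w : E}
    (hy : y ∈ {x | ∀ i, f i x ≤ b i}.extremePoints ℝ)
    (hw : ∀ i, f i y = b i → f i w = 0) : w = 0 := by
  -- Inactive constraints have room for a small move along `u`. Applied to `w` and `-w`, this makes
  -- `y` the midpoint of a feasible segment.
  have key : ∀ u : E, (∀ i, f i y = b i → f i u = 0) →
      ∀ᶠ s : ℝ in nhdsWithin 0 (Set.Ioi 0), ∀ i, f i (y + s • u) ≤ b i := by
    intro u hu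
    rw [Filter.eventually_all]
    intro i
    rcases (hy.1 i).eq_or_lt with h | h
    · exact Filter.Eventually.of_forall fun s => by simp [h, hu i h]
    · have hc : Filter.Tendsto (fun s : ℝ => f i y + s * f i u) (nhdsWithin 0 (Set.Ioi 0))
          (nhds (f i y)) := by
        have : Continuous fun s : ℝ => f i y + s * f i u := by fun_prop
        simpa using (this.tendsto 0).mono_left nhdsWithin_le_nhds
      filter_upwards [hc.eventually (gt_mem_nhds h)] with s hs
      simpa using hs.le
  obtain ⟨s, ⟨h1, h2⟩, hs⟩ := (((key w hw).and (key (-w) fun i h => by simp [hw i h])).and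
    self_mem_nhdsWithin).exists
  have hmem : y ∈ openSegment ℝ (y + s • w) (y + s • -w) :=
    ⟨1 / 2, 1 / 2, by norm_num, by norm_num, by norm_num, by module⟩
  have h3 := hy.2 h1 h2 hmem
  have h4 : s • w = 0 := by simpa using h3
  exact (smul_eq_zero.1 h4).resolve_left (ne_of_gt hs)

theorem injOn_active_extremePoints_polyhedron (f : ι → E →ₗ[ℝ] ℝ) (b : ι → ℝ) :
    Set.InjOn (fun y => {i | f i y = b i}) ({x | ∀ i, f i x ≤ b i}.extremePoints ℝ) := by
  intro y hy y' _ h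
  refine (sub_eq_zero.1 (eq_zero_of_mem_extremePoints_polyhedron f b hy
    (w := y' - y) fun i hi => ?_)).symm
  have : f i y' = b i := (Set.ext_iff.1 h i).1 hi
  rw [map_sub, this, hi, sub_self]

theorem finite_extremePoints_polyhedron (f : ι → E →ₗ[ℝ] ℝ) (b : ι → ℝ) :
    ({x | ∀ i, f i x ≤ b i}.extremePoints ℝ).Finite :=
  Set.Finite.of_finite_image (Set.toFinite _) (injOn_active_extremePoints_polyhedron f b)

end Polyhedron

/-! ### Vertices of a product of polygons -/

section Product

/-- The `i`-th pair of consecutive coordinates, as a continuous linear map. -/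
def coordPairCLM {d : ℕ} (i : Fin (d / 2)) : (Fin d → ℝ) →L[ℝ] (Fin 2 → ℝ) where
  toFun x := coordPair x i
  map_add' x y := by ext j; fin_cases j <;> simp [coordPair]
  map_smul' c x := by ext j; fin_cases j <;> simp [coordPair]
  cont := by
    refine continuous_pi fun j => ?_
    fin_cases j <;> simp [coordPair] <;> fun_prop

@[simp] theorem coordPairCLM_apply {d : ℕ} (i : Fin (d / 2)) (x : Fin d → ℝ) :
    coordPairCLM i x = coordPair x i := rfl

/-- The point with prescribed consecutive coordinate pairs, and last coordinate zero if the
dimension is odd. -/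
def ofCoordPairs {d : ℕ} (v : Fin (d / 2) → Fin 2 → ℝ) : Fin d → ℝ := fun j =>
  if h : (j : ℕ) / 2 < d / 2 then v ⟨j / 2, h⟩ ⟨j % 2, Nat.mod_lt _ two_pos⟩ else 0

theorem coordPair_ofCoordPairs {d : ℕ} (v : Fin (d / 2) → Fin 2 → ℝ) (i : Fin (d / 2)) :
    coordPair (ofCoordPairs v) i = v i := by
  have h1 : (2 * (i : ℕ)) / 2 = i := by omega
  have h2 : (2 * (i : ℕ) + 1) / 2 = i := by omega
  have h3 : (2 * (i : ℕ) + 1) % 2 = 1 := by omega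
  ext j
  fin_cases j
  · simp [coordPair, ofCoordPairs]
  · simp [coordPair, ofCoordPairs, h2, h3]

theorem ofCoordPairs_last {d : ℕ} (v : Fin (d / 2) → Fin 2 → ℝ) (h : Odd d) :
    ofCoordPairs v ⟨d - 1, Nat.sub_lt h.pos one_pos⟩ = 0 := by
  have : ¬ (d - 1) / 2 < d / 2 := by obtain ⟨k, rfl⟩ := h; omega
  simp [ofCoordPairs, this]

theorem eq_of_coordPair_eq {d : ℕ} {x y : Fin d → ℝ} (h : ∀ i, coordPair x i = coordPair y i)
    (hl : ∀ h : Odd d, x ⟨d - 1, Nat.sub_lt h.pos one_pos⟩ =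
      y ⟨d - 1, Nat.sub_lt h.pos one_pos⟩) : x = y := by
  ext j
  by_cases hj : (j : ℕ) / 2 < d / 2
  · have h0 := congrFun (h ⟨j / 2, hj⟩) 0
    have h1 := congrFun (h ⟨j / 2, hj⟩) 1
    simp only [coordPair, Matrix.cons_val_zero, Matrix.cons_val_one] at h0 h1
    rcases Nat.mod_two_eq_zero_or_one j with hm | hm
    · convert h0 using 2 <;> ext <;> simp <;> omega
    · convert h1 using 2 <;> ext <;> simp <;> omega
  · have hjd := j.2
    have hd : Odd d := by rw [Nat.odd_iff]; omega
    have := hl hd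
    convert this using 2 <;> ext <;> simp <;> omega

/-- The set of points whose coordinate pairs lie in the planar sets `Q i`, with nonnegative last
coordinate if the dimension is odd. -/
def coordPairProduct {d : ℕ} (Q : Fin (d / 2) → Set (Fin 2 → ℝ)) : Set (Fin d → ℝ) :=
  {x | (∀ i, coordPair x i ∈ Q i) ∧ ∀ h : Odd d, 0 ≤ x ⟨d - 1, Nat.sub_lt h.pos one_pos⟩}

/-- The exposing functional is the sum of those of the factors, minus the last coordinate when `d`
is odd; its maximum forces equality in every term. -/
theorem ofCoordPairs_mem_exposedPoints {d : ℕ} {Q : Fin (d / 2) → Set (Fin 2 → ℝ)}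
    {v : Fin (d / 2) → Fin 2 → ℝ} (hv : ∀ i, v i ∈ (Q i).exposedPoints ℝ) :
    ofCoordPairs v ∈ (coordPairProduct Q).exposedPoints ℝ := by
  choose hvQ l hl using hv
  let e : (Fin d → ℝ) →L[ℝ] ℝ :=
    if h : Odd d then ContinuousLinearMap.proj ⟨d - 1, Nat.sub_lt h.pos one_pos⟩ else 0
  have he0 : e (ofCoordPairs v) = 0 := by
    by_cases h : Odd d
    · simp only [e, dif_pos h, ContinuousLinearMap.proj_apply, ofCoordPairs_last v h]
    · simp [e, h]
  have he : ∀ y ∈ coordPairProduct Q, 0 ≤ e y := by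
    intro y hy
    by_cases h : Odd d
    · simpa [e, h] using hy.2 h
    · simp [e, h]
  refine ⟨⟨fun i => by rw [coordPair_ofCoordPairs]; exact hvQ i,
    fun h => (ofCoordPairs_last v h).ge⟩, ∑ i, (l i).comp (coordPairCLM i) - e, ?_⟩
  intro y hy
  have hle : ∀ i ∈ Finset.univ, l i (coordPair y i) ≤ l i (v i) :=
    fun i _ => (hl i _ (hy.1 i)).1
  simp only [sub_apply,
    ContinuousLinearMap.comp_apply, coordPairCLM_apply,
    coordPair_ofCoordPairs, he0, sum_apply]
  have hs := Finset.sum_le_sum hle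
  have hey := he y hy
  refine ⟨by linarith, fun h => ?_⟩
  have heq : ∀ i, l i (coordPair y i) = l i (v i) := by
    have := (Finset.sum_eq_sum_iff_of_le hle).1 (by linarith)
    exact fun i => this i (Finset.mem_univ i)
  refine eq_of_coordPair_eq (fun i => ?_) fun hd => ?_
  · rw [coordPair_ofCoordPairs]
    exact (hl i _ (hy.1 i)).2 (heq i).ge
  · rw [ofCoordPairs_last _ hd]
    have h0 : e y = 0 := by linarith
    simpa [e, hd] using h0

theorem finite_exposedPoints_coordPairProduct {d m : ℕ} {Q : Fin (d / 2) → Set (Fin 2 → ℝ)}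
    (hQ : ∀ i, IsPolygon m (Q i)) : ((coordPairProduct Q).exposedPoints ℝ).Finite := by
  choose _ _ A b hQ using hQ
  let f : (Fin (d / 2) × Fin m) ⊕ PLift (Odd d) → (Fin d → ℝ) →ₗ[ℝ] ℝ := Sum.elim
    (fun s => (LinearMap.proj s.2).comp ((A s.1).mulVecLin.comp (coordPairCLM s.1).toLinearMap))
    (fun h => -LinearMap.proj ⟨d - 1, Nat.sub_lt h.down.pos one_pos⟩)
  let c : (Fin (d / 2) × Fin m) ⊕ PLift (Odd d) → ℝ := Sum.elim (fun s => b s.1 s.2) 0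
  have h : coordPairProduct Q = {x | ∀ s, f s x ≤ c s} := by
    ext x
    simp [coordPairProduct, f, c, hQ, Pi.le_def, PLift.forall]
  rw [h]
  exact (finite_extremePoints_polyhedron f c).subset exposedPoints_subset_extremePoints

theorem pow_le_numFaces_coordPairProduct {d m : ℕ} (hm : 0 < m)
    {Q : Fin (d / 2) → Set (Fin 2 → ℝ)} (hQ : ∀ i, IsPolygon m (Q i)) :
    m ^ (d / 2) ≤ numFaces 0 (coordPairProduct Q) := by
  have hcard : ∀ i, ((Q i).exposedPoints ℝ).ncard = m := fun i => by
    rw [← numFaces_zero_eq_ncard_exposedPoints, (hQ i).2.1]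
  have hfin : ∀ i, ((Q i).exposedPoints ℝ).Finite := fun i =>
    Set.finite_of_ncard_pos (by rw [hcard]; exact hm)
  rw [numFaces_zero_eq_ncard_exposedPoints]
  have h := Set.ncard_le_ncard_of_injOn
    (s := (Fintype.piFinset fun i => (hfin i).toFinset : Set (Fin (d / 2) → Fin 2 → ℝ)))
    (t := (coordPairProduct Q).exposedPoints ℝ) ofCoordPairs
    (fun v hv => ofCoordPairs_mem_exposedPoints fun i => by simpa using Fintype.mem_piFinset.1 hv i)
    (fun v _ v' _ hvv => funext fun i => by
      rw [← coordPair_ofCoordPairs v, hvv, coordPair_ofCoordPairs])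
    (finite_exposedPoints_coordPairProduct hQ)
  rw [Set.ncard_coe_finset, Fintype.card_piFinset] at h
  simpa [← Set.ncard_eq_toFinset_card _ (hfin _), hcard] using h

end Product

/-! ### Counting sets that satisfy Gale's evenness condition -/

section Gale

variable {n : ℕ}

/-- The number of elements of `Z` greater than `j`. -/
def countAbove (Z : Finset (Fin n)) (j : Fin n) : ℕ := (Z.filter (j < ·)).card

/-- The elements of `Z` with an odd number of elements of `Z` above them. -/
def oddPart (Z : Finset (Fin n)) : Finset (Fin n) := Z.filter fun z => Odd (countAbove Z z)

theorem countAbove_of_succ {Z : Finset (Fin n)} {i j : Fin n} (h : (i : ℕ) + 1 = j) :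
    countAbove Z i = countAbove Z j + if j ∈ Z then 1 else 0 := by
  have hij : ∀ x : Fin n, i < x ↔ j < x ∨ x = j := fun x => by
    rw [Fin.lt_def, Fin.lt_def, Fin.ext_iff]; omega
  rw [countAbove, countAbove, Finset.filter_congr fun x _ => hij x, Finset.filter_or,
    Finset.card_union_of_disjoint, Finset.filter_eq']
  · split_ifs <;> simp
  · rw [Finset.disjoint_filter]
    rintro x _ hx rfl
    exact lt_irrefl _ hx

theorem countAbove_last {Z : Finset (Fin n)} {j : Fin n} (h : (j : ℕ) + 1 = n) :
    countAbove Z j = 0 := by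
  rw [countAbove, Finset.card_eq_zero, Finset.filter_eq_empty_iff]
  intro x _ hx
  have := x.2
  rw [Fin.lt_def] at hx
  omega

theorem countAbove_zero {Z : Finset (Fin n)} {j : Fin n} (h : (j : ℕ) = 0) (hj : j ∈ Z) :
    countAbove Z j + 1 = Z.card := by
  have : Z.filter (j < ·) = Z.erase j := by
    ext x
    simp only [Finset.mem_filter, Finset.mem_erase, Fin.lt_def, ne_eq, Fin.ext_iff]
    constructor <;> rintro ⟨h1, h2⟩
    · exact ⟨by omega, h1⟩
    · exact ⟨h2, by omega⟩
  rw [countAbove, this, Finset.card_erase_add_one hj]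

/-- `countAbove Z` ranks the elements of `Z` from the top, starting at 0. -/
theorem image_countAbove (Z : Finset (Fin n)) : Z.image (countAbove Z) = Finset.range Z.card := by
  have hlt : ∀ x ∈ Z, ∀ y ∈ Z, x < y → countAbove Z y < countAbove Z x := by
    intro x _ y hy hxy
    refine Finset.card_lt_card ⟨fun z hz => ?_, fun h => ?_⟩
    · rw [Finset.mem_filter] at hz ⊢
      exact ⟨hz.1, hxy.trans hz.2⟩
    · have := h (Finset.mem_filter.2 ⟨hy, hxy⟩)
      exact lt_irrefl _ (Finset.mem_filter.1 this).2
  have hinj : Set.InjOn (countAbove Z) Z := by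
    intro x hx y hy h
    rcases lt_trichotomy x y with hxy | hxy | hxy
    · exact absurd h (hlt x hx y hy hxy).ne'
    · exact hxy
    · exact absurd h (hlt y hy x hx hxy).ne
  refine Finset.eq_of_subset_of_card_le (fun r hr => ?_) ?_
  · obtain ⟨z, hz, rfl⟩ := Finset.mem_image.1 hr
    rw [Finset.mem_range]
    refine Finset.card_lt_card ⟨Finset.filter_subset _ _, fun h => ?_⟩
    exact lt_irrefl _ (Finset.mem_filter.1 (h hz)).2
  · rw [Finset.card_range, Finset.card_image_of_injOn hinj]

theorem card_filter_odd_range (d : ℕ) : ((Finset.range d).filter Odd).card = d / 2 := by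
  induction d with
  | zero => rfl
  | succ d ih =>
    rw [Finset.range_add_one, Finset.filter_insert]
    split_ifs with h
    · rw [Finset.card_insert_of_notMem (by simp), ih]
      rw [Nat.odd_iff] at h
      omega
    · rw [ih]
      rw [Nat.odd_iff] at h
      omega

theorem card_oddPart (Z : Finset (Fin n)) : (oddPart Z).card = Z.card / 2 := by
  have hinj : Set.InjOn (countAbove Z) Z := by
    rw [← Finset.card_image_iff, image_countAbove, Finset.card_range]
  rw [← card_filter_odd_range, ← image_countAbove, Finset.filter_image, oddPart,
    Finset.card_image_of_injOn]
  exact hinj.mono fun x hx => Finset.mem_of_mem_filter x hx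

/-- `Z` splits into adjacent pairs whose lower members form `oddPart Z`, plus the node 0 if `Z.card`
is odd. Hence `oddPart` determines `Z` once its cardinality is fixed. -/
theorem mem_iff_of_forall_even {Z : Finset (Fin n)} (hZ : ∀ j ∉ Z, Even (countAbove Z j))
    (j : Fin n) : j ∈ Z ↔ j ∈ oddPart Z ∨ (∃ i ∈ oddPart Z, (i : ℕ) + 1 = j) ∨
      ((j : ℕ) = 0 ∧ Odd Z.card) := by
  constructor
  · intro hj
    by_cases ho : Odd (countAbove Z j)
    · exact Or.inl (Finset.mem_filter.2 ⟨hj, ho⟩)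
    rw [Nat.not_odd_iff_even] at ho
    rcases Nat.eq_zero_or_pos (j : ℕ) with h0 | h0
    · refine Or.inr (Or.inr ⟨h0, ?_⟩)
      rw [← countAbove_zero h0 hj]
      exact ho.add_one
    · have hs : ((⟨j - 1, by omega⟩ : Fin n) : ℕ) + 1 = j := by simp; omega
      have hc := countAbove_of_succ (Z := Z) hs
      rw [if_pos hj] at hc
      have hodd : Odd (countAbove Z ⟨j - 1, by omega⟩) := by rw [hc]; exact ho.add_one
      refine Or.inr (Or.inl ⟨_, Finset.mem_filter.2 ⟨?_, hodd⟩, hs⟩)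
      by_contra h
      exact Nat.not_even_iff_odd.2 hodd (hZ _ h)
  · rintro (h | ⟨i, hi, hij⟩ | ⟨h0, ho⟩)
    · exact Finset.mem_of_mem_filter _ h
    · by_contra hj
      have hc := countAbove_of_succ (Z := Z) hij
      rw [if_neg hj, add_zero] at hc
      have := (Finset.mem_filter.1 hi).2
      rw [hc] at this
      exact Nat.not_even_iff_odd.2 this (hZ _ hj)
    · by_contra hj
      have : Z.filter (j < ·) = Z := Finset.filter_true_of_mem fun x hx => by
        rw [Fin.lt_def]
        have : x ≠ j := fun h => hj (h ▸ hx)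
        rw [ne_eq, Fin.ext_iff] at this
        omega
      have he := hZ j hj
      rw [countAbove, this] at he
      exact Nat.not_even_iff_odd.2 ho he

/-- Here the last node must lie in `Z`, and each element of `oddPart Z` is the upper member of an
adjacent pair, except possibly the node 0. -/
theorem mem_iff_of_forall_odd {Z : Finset (Fin n)} (hZ : ∀ j ∉ Z, Odd (countAbove Z j))
    (j : Fin n) : j ∈ Z ↔ j ∈ oddPart Z ∨ (∃ i ∈ oddPart Z, (j : ℕ) + 1 = i) ∨
      (j : ℕ) + 1 = n := by
  constructor
  · intro hj
    by_cases ho : Odd (countAbove Z j)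
    · exact Or.inl (Finset.mem_filter.2 ⟨hj, ho⟩)
    by_cases hn : (j : ℕ) + 1 = n
    · exact Or.inr (Or.inr hn)
    have hc := countAbove_of_succ (Z := Z) (i := j) (j := ⟨j + 1, by omega⟩) rfl
    have hmem : (⟨j + 1, by omega⟩ : Fin n) ∈ Z := by
      by_contra h
      rw [if_neg h, add_zero] at hc
      exact ho (hc ▸ hZ _ h)
    rw [if_pos hmem] at hc
    refine Or.inr (Or.inl ⟨_, Finset.mem_filter.2 ⟨hmem, ?_⟩, rfl⟩)
    rw [Nat.odd_iff] at ho ⊢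
    omega
  · rintro (h | ⟨i, hi, hij⟩ | h)
    · exact Finset.mem_of_mem_filter _ h
    · by_contra hj
      have hc := countAbove_of_succ (Z := Z) hij
      obtain ⟨hiZ, hio⟩ := Finset.mem_filter.1 hi
      rw [if_pos hiZ] at hc
      have := hZ j hj
      rw [Nat.odd_iff] at this hio
      omega
    · by_contra hj
      have := hZ j hj
      rw [countAbove_last h] at this
      exact absurd this (by decide)

theorem ncard_le_choose_of_injOn_oddPart {d N : ℕ} {𝒵 : Set (Finset (Fin n))}
    (hcard : ∀ Z ∈ 𝒵, Z.card = d) (hinj : Set.InjOn oddPart 𝒵) (U : Finset (Fin n))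
    (hU : ∀ Z ∈ 𝒵, oddPart Z ⊆ U) (hN : U.card ≤ N) : 𝒵.ncard ≤ N.choose (d / 2) := by
  refine le_trans (Set.ncard_le_ncard_of_injOn (t := (U.powersetCard (d / 2) : Set _)) oddPart
    (fun Z hZ => ?_) hinj (Finset.finite_toSet _)) ?_
  · rw [Finset.mem_coe, Finset.mem_powersetCard, card_oddPart, hcard Z hZ]
    exact ⟨hU Z hZ, rfl⟩
  · rw [Set.ncard_coe_finset, Finset.card_powersetCard]
    exact Nat.choose_le_choose _ hN

theorem ncard_forall_even_le (d : ℕ) (hn : 0 < n) :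
    {Z : Finset (Fin n) | Z.card = d ∧ ∀ j ∉ Z, Even (countAbove Z j)}.ncard ≤
      (n - 1).choose (d / 2) := by
  refine ncard_le_choose_of_injOn_oddPart (fun Z hZ => hZ.1) ?_
    -- The last node has nothing above it, so it is never in `oddPart Z`.
    (Finset.univ.erase ⟨n - 1, by omega⟩) ?_ (by simp)
  · intro Z hZ Z' hZ' h
    ext j
    rw [mem_iff_of_forall_even hZ.2, mem_iff_of_forall_even hZ'.2, h, hZ.1, hZ'.1]
  · intro Z _ z hz
    rw [Finset.mem_erase]
    refine ⟨?_, Finset.mem_univ _⟩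
    rintro rfl
    have := (Finset.mem_filter.1 hz).2
    rw [countAbove_last (by simp; omega)] at this
    exact absurd this (by decide)

theorem ncard_forall_odd_le (d : ℕ) (hn : 0 < n) :
    {Z : Finset (Fin n) | Z.card = d ∧ ∀ j ∉ Z, Odd (countAbove Z j)}.ncard ≤
      (if Even d then n else n - 1).choose (d / 2) := by
  have hinj : Set.InjOn oddPart
      {Z : Finset (Fin n) | Z.card = d ∧ ∀ j ∉ Z, Odd (countAbove Z j)} := by
    intro Z hZ Z' hZ' h
    ext j
    rw [mem_iff_of_forall_odd hZ.2, mem_iff_of_forall_odd hZ'.2, h]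
  split_ifs with hd
  · exact ncard_le_choose_of_injOn_oddPart (fun Z hZ => hZ.1) hinj Finset.univ
      (fun _ _ => Finset.subset_univ _) (by simp)
  · refine ncard_le_choose_of_injOn_oddPart (fun Z hZ => hZ.1) hinj
      -- If the node 0 lies in `Z`, it has `d - 1` elements above it, an even number for odd `d`.
      (Finset.univ.erase ⟨0, hn⟩) ?_ (by simp)
    intro Z hZ z hz
    rw [Finset.mem_erase]
    refine ⟨?_, Finset.mem_univ _⟩
    rintro rfl
    obtain ⟨hz, ho⟩ := Finset.mem_filter.1 hz
    have hc := countAbove_zero rfl hz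
    rw [hZ.1] at hc
    exact hd (hc ▸ ho.add_one)

end Gale

/-! ### Vertices of dual cyclic polytopes -/

section Cyclic

open Polynomial

theorem prod_sub_eq_neg_one_pow_mul {n : ℕ} {t : Fin n → ℝ} (ht : StrictMono t)
    {Z : Finset (Fin n)} {j : Fin n} (hj : j ∉ Z) :
    ∃ c : ℝ, 0 < c ∧ ∏ z ∈ Z, (t j - t z) = (-1) ^ countAbove Z j * c := by
  refine ⟨∏ z ∈ Z, |t j - t z|, Finset.prod_pos fun z hz => abs_pos.2 (sub_ne_zero.2
    (ht.injective.ne fun h => hj (h ▸ hz))), ?_⟩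
  rw [countAbove, ← Finset.prod_const, Finset.prod_filter, ← Finset.prod_mul_distrib]
  refine Finset.prod_congr rfl fun z _ => ?_
  split_ifs with h
  · rw [abs_of_neg (sub_neg.2 (ht h)), neg_one_mul, neg_neg]
  · rw [abs_of_nonneg (sub_nonneg.2 (ht.monotone (not_lt.1 h))), one_mul]

/-- Gale's evenness condition for the zero set of a polynomial which is nonnegative at the nodes
and vanishes at as many nodes as its degree allows. -/
theorem forall_even_or_forall_odd_countAbove {n : ℕ} {t : Fin n → ℝ} (ht : StrictMono t)
    {q : ℝ[X]} (hq : ∀ i, 0 ≤ q.eval (t i)) {Z : Finset (Fin n)}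
    (hZ : ∀ i, i ∈ Z ↔ q.eval (t i) = 0) (hdeg : q.natDegree ≤ Z.card) :
    (∀ j ∉ Z, Even (countAbove Z j)) ∨ ∀ j ∉ Z, Odd (countAbove Z j) := by
  have hdvd : ∏ z ∈ Z, (X - C (t z)) ∣ q :=
    Finset.prod_dvd_of_coprime (fun i _ j _ hij => pairwise_coprime_X_sub_C ht.injective hij)
      fun z hz => dvd_iff_isRoot.2 ((hZ z).1 hz)
  have hqe := eq_leadingCoeff_mul_of_monic_of_dvd_of_natDegree_le
    (monic_prod_of_monic _ _ fun z _ => monic_X_sub_C (t z)) hdvd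
    (by rwa [natDegree_finsetProd_X_sub_C_eq_card])
  have heval : ∀ j ∉ Z, ∃ c : ℝ, 0 < c ∧ 0 < q.leadingCoeff * ((-1) ^ countAbove Z j * c) := by
    intro j hj
    obtain ⟨c, hc, h⟩ := prod_sub_eq_neg_one_pow_mul ht hj
    refine ⟨c, hc, ?_⟩
    have hpos : 0 < q.eval (t j) := (hq j).lt_of_ne' fun h0 => hj ((hZ j).2 h0)
    rw [hqe] at hpos
    simpa [eval_prod, h] using hpos
  rcases le_total 0 q.leadingCoeff with ha | ha
  · left
    intro j hj
    obtain ⟨c, hc, h⟩ := heval j hj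
    by_contra ho
    rw [(Nat.not_even_iff_odd.1 ho).neg_one_pow] at h
    nlinarith [mul_nonneg ha hc.le]
  · right
    intro j hj
    obtain ⟨c, hc, h⟩ := heval j hj
    by_contra ho
    rw [(Nat.not_odd_iff_even.1 ho).neg_one_pow] at h
    nlinarith [mul_nonneg (neg_nonneg.2 ha) hc.le]

/-- The polynomial whose value at `s` is `1 - y ⬝ᵥ (momentCurve d s - p)`. -/
noncomputable def slackPolynomial {d : ℕ} (p y : Fin d → ℝ) : ℝ[X] :=
  C (1 + y ⬝ᵥ p) - ∑ j : Fin d, C (y j) * X ^ ((j : ℕ) + 1)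

theorem eval_slackPolynomial {d : ℕ} (p y : Fin d → ℝ) (s : ℝ) :
    (slackPolynomial p y).eval s = 1 - y ⬝ᵥ (momentCurve d s - p) := by
  rw [dotProduct_sub]
  simp only [slackPolynomial, eval_sub, eval_C, eval_finsetSum, eval_mul, eval_pow, eval_X,
    momentCurve, dotProduct]
  ring

theorem natDegree_slackPolynomial_le {d : ℕ} (p y : Fin d → ℝ) :
    (slackPolynomial p y).natDegree ≤ d := by
  refine (natDegree_sub_le _ _).trans (max_le (by simp) ?_)
  refine natDegree_sum_le_of_forall_le _ _ fun j _ => ?_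
  exact (natDegree_C_mul_X_pow_le _ _).trans j.2

theorem slackPolynomial_ne_zero {d : ℕ} (p y : Fin d → ℝ) : slackPolynomial p y ≠ 0 := by
  intro h
  have hy : y = 0 := by
    ext i
    have := congrArg (fun q => q.coeff ((i : ℕ) + 1)) h
    simpa [slackPolynomial, coeff_C, coeff_one, coeff_X_pow, ← Fin.ext_iff] using this
  have := congrArg (fun q => q.coeff 0) h
  simp [slackPolynomial, hy] at this

theorem polarDual_cyclicPolytope {n d : ℕ} (t : Fin n → ℝ) (p : Fin d → ℝ) :
    polarDual p (cyclicPolytope d t) = {y | ∀ i, y ⬝ᵥ (momentCurve d (t i) - p) ≤ 1} := by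
  ext y
  refine ⟨fun h i => h _ (subset_convexHull ℝ _ ⟨i, rfl⟩), fun h x hx => ?_⟩
  have hconv : Convex ℝ {x : Fin d → ℝ | y ⬝ᵥ (x - p) ≤ 1} := by
    simp only [dotProduct_sub, sub_le_iff_le_add]
    exact convex_halfSpace_le (dotProductBilin ℝ ℝ y).isLinear _
  exact convexHull_min (by rintro _ ⟨i, rfl⟩; exact h i) hconv hx

theorem numFaces_polarDual_cyclicPolytope_le {n d : ℕ} (hn : 0 < n) {t : Fin n → ℝ}
    (ht : StrictMono t) (p : Fin d → ℝ) :
    numFaces 0 (polarDual p (cyclicPolytope d t)) ≤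
      2 * (if Even d then n else n - 1).choose (d / 2) := by
  classical
  let f : Fin n → (Fin d → ℝ) →ₗ[ℝ] ℝ := fun i =>
    (dotProductBilin ℝ ℝ).flip (momentCurve d (t i) - p)
  have hf : ∀ i y, f i y = y ⬝ᵥ (momentCurve d (t i) - p) := fun i y => rfl
  have hset : polarDual p (cyclicPolytope d t) = {y | ∀ i, f i y ≤ (fun _ => 1) i} :=
    polarDual_cyclicPolytope t p
  let Z : (Fin d → ℝ) → Finset (Fin n) := fun y => Finset.univ.filter fun i => f i y = 1
  have hZ : ∀ y i, i ∈ Z y ↔ (slackPolynomial p y).eval (t i) = 0 := by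
    intro y i
    rw [eval_slackPolynomial, ← hf, sub_eq_zero, eq_comm]
    simp [Z]
  have hle : ∀ y, (Z y).card ≤ d := by
    intro y
    refine le_trans ?_ (natDegree_slackPolynomial_le p y)
    rw [← Finset.card_image_of_injective _ ht.injective]
    refine card_le_degree_of_subset_roots fun s hs => ?_
    obtain ⟨i, hi, rfl⟩ := Finset.mem_image.1 (Finset.mem_val ▸ hs)
    exact (mem_roots (slackPolynomial_ne_zero p y)).2 ((hZ y i).1 hi)
  have hcard : ∀ y ∈ {y | ∀ i, f i y ≤ (fun _ => 1) i}.extremePoints ℝ, (Z y).card = d := by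
    intro y hy
    refine (hle y).antisymm (not_lt.1 fun hlt => ?_)
    -- Fewer than `d` active functionals on a `d`-dimensional space would have a nonzero common
    -- kernel vector.
    refine LinearMap.ker_ne_bot_of_finrank_lt
      (f := LinearMap.pi fun i : Z y => f i) (by simpa using hlt) ?_
    refine (Submodule.eq_bot_iff _).2 fun w hw => ?_
    refine eq_zero_of_mem_extremePoints_polyhedron f _ hy fun i hi => ?_
    exact congrFun (LinearMap.mem_ker.1 hw) ⟨i, by simpa [Z] using hi⟩
  have hinj : Set.InjOn Z ({y | ∀ i, f i y ≤ (fun _ => 1) i}.extremePoints ℝ) := by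
    intro y hy y' hy' h
    refine injOn_active_extremePoints_polyhedron f _ hy hy' (Set.ext fun i => ?_)
    simpa [Z] using Finset.ext_iff.1 h i
  rw [numFaces_zero_eq_ncard_exposedPoints, hset]
  have hmaps : ∀ y ∈ {y | ∀ i, f i y ≤ (fun _ => 1) i}.exposedPoints ℝ,
      Z y ∈ {Z : Finset (Fin n) | Z.card = d ∧ ∀ j ∉ Z, Even (countAbove Z j)} ∪
        {Z : Finset (Fin n) | Z.card = d ∧ ∀ j ∉ Z, Odd (countAbove Z j)} := by
    intro y hy
    have hc := hcard y (exposedPoints_subset_extremePoints hy)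
    refine (forall_even_or_forall_odd_countAbove ht (fun i => ?_) (hZ y) ?_).imp
      (fun h => ⟨hc, h⟩) fun h => ⟨hc, h⟩
    · rw [eval_slackPolynomial, sub_nonneg]
      exact hy.1 i
    · rw [hc]
      exact natDegree_slackPolynomial_le p y
  refine (Set.ncard_le_ncard_of_injOn Z hmaps
    (hinj.mono exposedPoints_subset_extremePoints) (Set.toFinite _)).trans
    ((Set.ncard_union_le _ _).trans ?_)
  rw [two_mul]
  refine add_le_add ((ncard_forall_even_le d hn).trans (Nat.choose_le_choose _ ?_))
    (ncard_forall_odd_le d hn)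
  split_ifs <;> omega

end Cyclic

theorem choose_mul_le_exp_pow_mul_pow (m k : ℕ) :
    ((m * k).choose k : ℝ) ≤ Real.exp 1 ^ k * (m : ℝ) ^ k := by
  have h1 : ((m * k).choose k : ℝ) ≤ ((m * k : ℕ) : ℝ) ^ k / k.factorial :=
    Nat.choose_le_pow_div k (m * k)
  have h2 := Real.pow_div_factorial_le_exp (k : ℝ) k.cast_nonneg k
  rw [← Real.exp_nat_mul, mul_one]
  calc ((m * k).choose k : ℝ) ≤ ((m * k : ℕ) : ℝ) ^ k / k.factorial := h1
    _ = (k : ℝ) ^ k / k.factorial * (m : ℝ) ^ k := by rw [Nat.cast_mul, mul_pow]; ring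
    _ ≤ Real.exp k * (m : ℝ) ^ k := by gcongr

theorem mainTheorem5 :
    ∃ C : ℝ, 0 < C ∧ ∀ n d : ℕ, d < n →
      (Even d → d / 2 ∣ n) → (Odd d → d / 2 ∣ n - 1) →
      ∀ c P : Set (Fin d → ℝ), IsDualCyclicPolytope n d c → IsPStar n d P →
        (numFaces 0 c : ℝ) ≤ C * Real.exp 1 ^ (d / 2) * (numFaces 0 P : ℝ) := by
  -- One factor for each parity in Gale's condition.
  refine ⟨2, two_pos, ?_⟩
  rintro n d hdn heven hodd c P ⟨t, ht, p, -, rfl⟩ ⟨Q, hQ, rfl⟩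
  have hN : ∃ m, 0 < m ∧ (if Even d then n else n - 1) = m * (d / 2) ∧
      (if Even d then n / (d / 2) else (n - 1) / (d / 2)) = m := by
    -- A divisor of a positive number is positive, which excludes `d / 2 = 0`, that is `d < 2`.
    have aux : ∀ N, 0 < N → d / 2 ∣ N → 0 < N / (d / 2) ∧ N = N / (d / 2) * (d / 2) :=
      fun N hN h => ⟨Nat.div_pos (Nat.le_of_dvd hN h) (Nat.pos_of_dvd_of_pos h hN),
        (Nat.div_mul_cancel h).symm⟩
    by_cases hd : Even d
    · simp only [if_pos hd]
      exact ⟨_, (aux n (by omega) (heven hd)).1, (aux n (by omega) (heven hd)).2, rfl⟩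
    · have ho := Nat.not_even_iff_odd.1 hd
      have := ho.pos
      simp only [if_neg hd]
      exact ⟨_, (aux (n - 1) (by omega) (hodd ho)).1, (aux (n - 1) (by omega) (hodd ho)).2, rfl⟩
  obtain ⟨m, hm, hNm, hdiv⟩ := hN
  rw [hdiv] at hQ
  have hP : (m : ℝ) ^ (d / 2) ≤ numFaces 0 (coordPairProduct Q) := by
    exact_mod_cast pow_le_numFaces_coordPairProduct hm hQ
  have hc : (numFaces 0 (polarDual p (cyclicPolytope d t)) : ℝ) ≤
      2 * ((m * (d / 2)).choose (d / 2) : ℝ) := by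
    rw [← hNm]
    exact_mod_cast numFaces_polarDual_cyclicPolytope_le (by omega) ht p
  calc (numFaces 0 (polarDual p (cyclicPolytope d t)) : ℝ)
      ≤ 2 * (Real.exp 1 ^ (d / 2) * (m : ℝ) ^ (d / 2)) :=
        hc.trans (by gcongr; exact choose_mul_le_exp_pow_mul_pow m (d / 2))
    _ ≤ 2 * (Real.exp 1 ^ (d / 2) * numFaces 0 (coordPairProduct Q)) := by gcongr
    _ = 2 * Real.exp 1 ^ (d / 2) * numFaces 0 (coordPairProduct Q) := by ring
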